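/- **Definitions.** An integral domain $D$ is *atomic* if every non-zero non-unit of $D$ is a finite product of irreducible elements. Write $a\sim b$ if $a$ and $b$ are associates in $D$. An *irreducible divisor pair domain* (IDPD) is an atomic integral domain $D$ such that for every non-zero non-unit $z\in D$ and all non-associate irreducible divisors $p,q$ of $z$, there exist irreducible elements $p',q'\in D$ with $pp'\sim qq'$ and $qq'\mid z$. An *imaginary quadratic order* is a ring isomorphic to a subring of an imaginary quadratic field $K$ (a field of degree $2$ over $\mathbb{Q}$ with no real embedding) that is finitely generated as an abelian group and spans $K$ over $\mathbb{Q}$. **Theorem.** The ring $\mathbb{Z}[\sqrt{-3}]$ is an IDPD. Moreover, up to ring isomorphism, it is the unique imaginary quadratic order that is an IDPD and is not integrally closed (in its field of fractions); that is, $\mathbb{Z}[\sqrt{-3}]$ is an imaginary quadratic order that is not integrally closed, and every imaginary quadratic order that is not integrally closed and is an IDPD is isomorphic to $\mathbb{Z}[\sqrt{-3}]$ as a ring. -/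

import Mathlib

universe u

/-- Irreducible divisor pair domains: atomic integral domains `D` such that for all non-associate
irreducible divisors `p`, `q` of a non-zero non-unit `z` there are irreducible `p'`, `q'` with
`p * p' ∼ q * q'` and `q * q' ∣ z`. -/
structure IsIDPD (D : Type u) [CommRing D] : Prop where
  isDomain : IsDomain D
  /-- atomicity: every non-zero non-unit is a finite product of irreducible elements -/
  atomic : ∀ z : D, z ≠ 0 → ¬ IsUnit z →
    ∃ s : Multiset D, (∀ p ∈ s, Irreducible p) ∧ s.prod = z
  exists_pair : ∀ z : D, z ≠ 0 → ¬ IsUnit z →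
    ∀ p q : D, Irreducible p → Irreducible q → p ∣ z → q ∣ z → ¬ Associated p q →
      ∃ p' q' : D, Irreducible p' ∧ Irreducible q' ∧
        Associated (p * p') (q * q') ∧ q * q' ∣ z

/-- An order in a number field `K`: a subring of `K` that is finitely generated as an abelian
group and spans `K` over `ℚ`. -/
structure IsNumberFieldOrder {K : Type u} [Field K] [NumberField K] (O : Subring K) : Prop where
  finite : Module.Finite ℤ O
  span_eq_top : Submodule.span ℚ (O : Set K) = ⊤

/-- An imaginary quadratic field: a number field of degree `2` over `ℚ` without real embeddings. -/
structure IsImaginaryQuadraticField (K : Type u) [Field K] [NumberField K] : Prop where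
  finrank_eq_two : Module.finrank ℚ K = 2
  isTotallyComplex : NumberField.IsTotallyComplex K

/-- A commutative ring is an imaginary quadratic order if it is isomorphic to an order in some
imaginary quadratic field. -/
def IsImaginaryQuadraticOrder (D : Type u) [CommRing D] : Prop :=
  ∃ (K : Type u) (_ : Field K) (_ : NumberField K), IsImaginaryQuadraticField K ∧
    ∃ O : Subring K, IsNumberFieldOrder O ∧ Nonempty (D ≃+* O)

/-! Uniqueness. A non-integrally closed imaginary quadratic order can be written `ℤ + pℤω` inside `R
= ℤ[ω]`, with `p` prime, `ω² = a + bω` and `b ∈ {0, 1}` (`exists_isOrderEmbedding`). An IDPD is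
half-factorial (`card_eq_card`). If `pα` were irreducible with `α ∈ R` a non-zero non-unit, then
`(pα)(p·star α) = p·p·N(α)` would have factorizations of length two and of length at least three. So
`pα` always splits, and descent on the norm makes every element of `R` a unit times an element of
the order (`exists_isUnit_mul`). Hence every norm from `R` is already a norm from the order, where
small norms are squares; testing `ω` and `1 + ω` leaves only `a = -1`, `b = 1`, `p = 2`
(`eq_of_isIDPD`).

Existence. For these values `R` is the ring of Eisenstein integers, which is Euclidean, in which `2`
is prime and whose units represent every non-zero class mod `2`. Irreducibles of `ℤ[√-3]` therefore
remain prime in `R`, and the pair condition reduces to divisibility there; only elements divisible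
by `2` need care. -/

namespace QuadraticAlgebra

/-! ### Norms in definite quadratic algebras. -/

theorem four_mul_norm {a b : ℤ} (z : QuadraticAlgebra ℤ a b) :
    4 * norm z = (2 * z.re + b * z.im) ^ 2 - (b ^ 2 + 4 * a) * z.im ^ 2 := by
  rw [norm_def]; ring

theorem norm_nonneg_of_disc_neg {a b : ℤ} (h : b ^ 2 + 4 * a < 0) (z : QuadraticAlgebra ℤ a b) :
    0 ≤ norm z := by
  have := four_mul_norm z
  nlinarith [sq_nonneg (2 * z.re + b * z.im), sq_nonneg z.im]

theorem norm_eq_zero_iff_of_disc_neg {a b : ℤ} (h : b ^ 2 + 4 * a < 0)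
    {z : QuadraticAlgebra ℤ a b} : norm z = 0 ↔ z = 0 := by
  refine ⟨fun hz => ?_, fun hz => by rw [hz, norm_zero]⟩
  have h4 := four_mul_norm z
  have him : z.im = 0 := by
    by_contra hne
    have : 0 < z.im ^ 2 := by positivity
    nlinarith [sq_nonneg (2 * z.re + b * z.im)]
  have hre : z.re = 0 := by
    rw [hz, him] at h4
    nlinarith
  ext <;> simp [him, hre]

theorem norm_pos_of_disc_neg {a b : ℤ} (h : b ^ 2 + 4 * a < 0) {z : QuadraticAlgebra ℤ a b}
    (hz : z ≠ 0) : 0 < norm z :=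
  lt_of_le_of_ne (norm_nonneg_of_disc_neg h z)
    fun h0 => hz ((norm_eq_zero_iff_of_disc_neg h).1 h0.symm)

theorem isUnit_iff_norm_eq_one {a b : ℤ} (h : b ^ 2 + 4 * a < 0) {z : QuadraticAlgebra ℤ a b} :
    IsUnit z ↔ norm z = 1 := by
  rw [isUnit_iff_norm_isUnit, Int.isUnit_iff]
  have := norm_nonneg_of_disc_neg h z
  omega

theorem isDomain_of_disc_neg {a b : ℤ} (h : b ^ 2 + 4 * a < 0) :
    IsDomain (QuadraticAlgebra ℤ a b) := by
  have : NoZeroDivisors (QuadraticAlgebra ℤ a b) := ⟨fun {x y} hxy => by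
    rw [← norm_eq_zero_iff_of_disc_neg h, map_mul, mul_eq_zero] at hxy
    rwa [norm_eq_zero_iff_of_disc_neg h, norm_eq_zero_iff_of_disc_neg h] at hxy⟩
  exact NoZeroDivisors.to_isDomain _

end QuadraticAlgebra

/-! ### Orders `ℤ + pℤω`: units and atomicity through the norm. -/

open QuadraticAlgebra in
/-- `φ` identifies `D` with the subring `ℤ + pℤω` of the definite quadratic algebra `ℤ[ω]`. -/
structure IsOrderEmbedding {D : Type u} [CommRing D] {a b : ℤ} (p : ℤ)
    (φ : D →+* QuadraticAlgebra ℤ a b) : Prop where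
  disc_neg : b ^ 2 + 4 * a < 0
  injective : Function.Injective φ
  exists_iff : ∀ z, (∃ d, φ d = z) ↔ p ∣ z.im

namespace IsOrderEmbedding

open QuadraticAlgebra

theorem dvd_im {D : Type u} [CommRing D] {a b p : ℤ} {φ : D →+* QuadraticAlgebra ℤ a b}
    (hφ : IsOrderEmbedding p φ) (d : D) : p ∣ (φ d).im :=
  (hφ.exists_iff _).1 ⟨d, rfl⟩

theorem isDomain {D : Type u} [CommRing D] {a b p : ℤ} {φ : D →+* QuadraticAlgebra ℤ a b}
    (hφ : IsOrderEmbedding p φ) : IsDomain D :=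
  have := isDomain_of_disc_neg hφ.disc_neg
  hφ.injective.isDomain φ

theorem exists_star {D : Type u} [CommRing D] {a b p : ℤ} {φ : D →+* QuadraticAlgebra ℤ a b}
    (hφ : IsOrderEmbedding p φ) (d : D) : ∃ e, φ e = star (φ d) := by
  rw [hφ.exists_iff, im_star, dvd_neg]
  exact hφ.dvd_im d

theorem mul_of_eq_star {D : Type u} [CommRing D] {a b p : ℤ} {φ : D →+* QuadraticAlgebra ℤ a b}
    (hφ : IsOrderEmbedding p φ) {d e : D} (he : φ e = star (φ d)) :
    d * e = ((norm (φ d) : ℤ) : D) := by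
  apply hφ.injective
  rw [map_mul, he, ← algebraMap_norm_eq_mul_star, map_intCast]
  rfl

theorem isUnit_iff {D : Type u} [CommRing D] {a b p : ℤ} {φ : D →+* QuadraticAlgebra ℤ a b}
    (hφ : IsOrderEmbedding p φ) {d : D} : IsUnit d ↔ norm (φ d) = 1 := by
  refine ⟨fun hd => (isUnit_iff_norm_eq_one hφ.disc_neg).1 (hd.map φ), fun hd => ?_⟩
  obtain ⟨e, he⟩ := hφ.exists_star d
  exact IsUnit.of_mul_eq_one e (by rw [hφ.mul_of_eq_star he, hd, Int.cast_one])

theorem norm_pos {D : Type u} [CommRing D] {a b p : ℤ} {φ : D →+* QuadraticAlgebra ℤ a b}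
    (hφ : IsOrderEmbedding p φ) {d : D} (hd : d ≠ 0) : 0 < norm (φ d) :=
  norm_pos_of_disc_neg hφ.disc_neg ((map_ne_zero_iff φ hφ.injective).2 hd)

theorem one_lt_norm {D : Type u} [CommRing D] {a b p : ℤ} {φ : D →+* QuadraticAlgebra ℤ a b}
    (hφ : IsOrderEmbedding p φ) {d : D} (hd : d ≠ 0) (hu : ¬ IsUnit d) : 1 < norm (φ d) := by
  have := hφ.norm_pos hd
  rw [hφ.isUnit_iff] at hu
  omega

theorem exists_multiset {D : Type u} [CommRing D] {a b p : ℤ} {φ : D →+* QuadraticAlgebra ℤ a b}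
    (hφ : IsOrderEmbedding p φ) (z : D) (hz : z ≠ 0) (hu : ¬ IsUnit z) :
    ∃ s : Multiset D, (∀ q ∈ s, Irreducible q) ∧ s.prod = z := by
  have := hφ.isDomain
  induction hn : (norm (φ z)).natAbs using Nat.strong_induction_on generalizing z with
  | _ n ih =>
  by_cases hirr : Irreducible z
  · exact ⟨{z}, by simpa using hirr, by simp⟩
  rw [irreducible_iff] at hirr
  push Not at hirr
  obtain ⟨x, y, rfl, hx, hy⟩ := hirr hu
  have hx0 : x ≠ 0 := left_ne_zero_of_mul hz
  have hy0 : y ≠ 0 := right_ne_zero_of_mul hz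
  have hx1 := hφ.one_lt_norm hx0 hx
  have hy1 := hφ.one_lt_norm hy0 hy
  have hN : norm (φ (x * y)) = norm (φ x) * norm (φ y) := by rw [map_mul, map_mul]
  have hltx : (norm (φ x)).natAbs < n := by
    rw [← hn, hN]
    exact Int.natAbs_lt_natAbs_of_nonneg_of_lt (by omega) (by nlinarith)
  have hlty : (norm (φ y)).natAbs < n := by
    rw [← hn, hN]
    exact Int.natAbs_lt_natAbs_of_nonneg_of_lt (by omega) (by nlinarith)
  obtain ⟨s, hs, rfl⟩ := ih _ hltx x hx0 hx rfl
  obtain ⟨t, ht, rfl⟩ := ih _ hlty y hy0 hy rfl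
  refine ⟨s + t, fun q hq => ?_, Multiset.prod_add s t⟩
  exact (Multiset.mem_add.1 hq).elim (hs q) (ht q)

end IsOrderEmbedding

/-! ### Half-factoriality. -/

namespace IsIDPD

theorem exists_multiset_associated {D : Type u} [CommRing D] (hD : IsIDPD D) {z : D}
    (hz : z ≠ 0) : ∃ s : Multiset D, (∀ p ∈ s, Irreducible p) ∧ Associated s.prod z := by
  by_cases hu : IsUnit z
  · exact ⟨0, by simp, by simpa using (associated_one_iff_isUnit.2 hu).symm⟩
  · obtain ⟨s, hs, rfl⟩ := hD.atomic z hz hu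
    exact ⟨s, hs, Associated.refl _⟩

/-- Irreducible divisor pair domains are half-factorial. -/
theorem card_eq_card {D : Type u} [CommRing D] (hD : IsIDPD D) (s t : Multiset D)
    (hs : ∀ p ∈ s, Irreducible p) (ht : ∀ p ∈ t, Irreducible p)
    (h : Associated s.prod t.prod) : s.card = t.card := by
  have := hD.isDomain
  have key : ∀ r : Multiset D, (∀ p ∈ r, Irreducible p) → IsUnit r.prod → r = 0 := by
    intro r hr hu
    refine Multiset.eq_zero_of_forall_notMem fun p hp => (hr p hp).not_isUnit ?_
    exact isUnit_of_dvd_unit (Multiset.dvd_prod hp) hu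
  have h0 : ∀ r : Multiset D, (∀ p ∈ r, Irreducible p) → r.prod ≠ 0 := by
    intro r hr h0
    exact (hr 0 (Multiset.prod_eq_zero_iff.1 h0)).ne_zero rfl
  induction hn : s.card generalizing s t with
  | zero =>
    obtain rfl := Multiset.card_eq_zero.1 hn
    rw [key t ht (by simpa using h.symm)]; simp
  | succ n ih =>
    obtain ⟨p, hps⟩ := Multiset.card_pos_iff_exists_mem.1 (by omega : 0 < s.card)
    obtain ⟨s, rfl⟩ := Multiset.exists_cons_of_mem hps
    have hp := hs p (Multiset.mem_cons_self _ _)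
    have hs' : ∀ x ∈ s, Irreducible x := fun x hx => hs x (Multiset.mem_cons_of_mem hx)
    have hsn : s.card = n := by simpa using hn
    rcases Multiset.empty_or_exists_mem t with rfl | ⟨q, hq⟩
    · exact absurd (isUnit_of_dvd_one ((Multiset.dvd_prod (Multiset.mem_cons_self p s)).trans
        (by simpa using h.dvd))) hp.not_isUnit
    obtain ⟨t, rfl⟩ := Multiset.exists_cons_of_mem hq
    have hq := ht q (Multiset.mem_cons_self _ _)
    have ht' : ∀ x ∈ t, Irreducible x := fun x hx => ht x (Multiset.mem_cons_of_mem hx)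
    simp only [Multiset.prod_cons, Multiset.card_cons] at h ⊢
    by_cases hpq : Associated p q
    · rw [ih s t hs' ht' (h.of_mul_left hpq hp.ne_zero) hsn]
    have hz : p * s.prod ≠ 0 := mul_ne_zero hp.ne_zero (h0 s hs')
    -- Here `z = qq'w ∼ pp'w`. With `r` a factorization of `w`, cancelling `p` and `q` compares the
    -- tail of the first list with `p' ::ₘ r` and that of the second with `q' ::ₘ r`, two lists of
    -- the same length.
    obtain ⟨p', q', hp', hq', hass, w, hw⟩ := hD.exists_pair (p * s.prod) hz
      (fun hu => hp.not_isUnit (isUnit_of_mul_isUnit_left hu)) p q hp hq (dvd_mul_right _ _)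
      ((dvd_mul_right q t.prod).trans h.symm.dvd) hpq
    have hw0 : w ≠ 0 := by rintro rfl; simp [hw] at hz
    obtain ⟨r, hr, hrw⟩ := hD.exists_multiset_associated hw0
    have h1 : Associated s.prod (p' ::ₘ r).prod := by
      refine Associated.of_mul_left (?_ : Associated (p * s.prod) (p * (p' ::ₘ r).prod))
        (Associated.refl p) hp.ne_zero
      rw [hw, Multiset.prod_cons, ← mul_assoc]
      exact hass.symm.mul_mul hrw.symm
    have h2 : Associated (q' ::ₘ r).prod t.prod := by
      refine Associated.of_mul_left (?_ : Associated (q * (q' ::ₘ r).prod) (q * t.prod))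
        (Associated.refl q) hq.ne_zero
      rw [Multiset.prod_cons, ← mul_assoc]
      refine Associated.trans ?_ h
      rw [hw]
      exact hrw.mul_left _
    have hr1 : ∀ x ∈ p' ::ₘ r, Irreducible x := by
      intro x hx
      rcases Multiset.mem_cons.1 hx with rfl | hx
      exacts [hp', hr x hx]
    have hr2 : ∀ x ∈ q' ::ₘ r, Irreducible x := by
      intro x hx
      rcases Multiset.mem_cons.1 hx with rfl | hx
      exacts [hq', hr x hx]
    have c1 := ih s _ hs' hr1 h1 hsn
    have c2 := ih (q' ::ₘ r) t hr2 ht' h2 (by simpa using c1.symm)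
    omega

end IsIDPD

/-! ### Constraints that the pair condition puts on `a`, `b`, `p`. -/

namespace IsOrderEmbedding

open QuadraticAlgebra

/-- As `p` divides the `im` coordinate, the norm is congruent to `re ^ 2` mod `p`. -/
theorem exists_eq_mul_of_dvd_norm {D : Type u} [CommRing D] {a b p : ℤ}
    {φ : D →+* QuadraticAlgebra ℤ a b} (hφ : IsOrderEmbedding p φ) (hp : Prime p) {d : D}
    (hd : p ∣ norm (φ d)) : ∃ β, φ d = (p : QuadraticAlgebra ℤ a b) * β := by
  obtain ⟨y, hy⟩ := hφ.dvd_im d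
  have hx : p ∣ (φ d).re := by
    rw [norm_def, hy] at hd
    refine hp.dvd_of_dvd_pow (n := 2) ?_
    have := dvd_sub hd (Dvd.intro (b * (φ d).re * y - a * (p * y) * y)
      (show p * (b * (φ d).re * y - a * (p * y) * y) =
        b * (φ d).re * (p * y) - a * (p * y) * (p * y) by ring))
    convert this using 1
    ring
  obtain ⟨x, hx⟩ := hx
  exact ⟨⟨x, y⟩, by ext <;> simp [hx, hy]⟩

theorem irreducible_of_eq_star {D : Type u} [CommRing D] {a b p : ℤ}
    {φ : D →+* QuadraticAlgebra ℤ a b} (hφ : IsOrderEmbedding p φ) {d e : D}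
    (he : φ e = star (φ d)) (hd : Irreducible d) : Irreducible e := by
  refine ⟨fun hu => hd.not_isUnit ?_, fun x y hxy => ?_⟩
  · rw [hφ.isUnit_iff, he, QuadraticAlgebra.norm_star] at hu
    exact hφ.isUnit_iff.2 hu
  · obtain ⟨x', hx'⟩ := hφ.exists_star x
    obtain ⟨y', hy'⟩ := hφ.exists_star y
    have hxy' : d = x' * y' := by
      apply hφ.injective
      rw [map_mul, hx', hy', mul_comm, ← star_mul, ← map_mul, ← hxy, he, star_star]
    refine (hd.isUnit_or_isUnit hxy').imp (fun hu => ?_) fun hu => ?_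
    · rw [hφ.isUnit_iff, hx', QuadraticAlgebra.norm_star] at hu
      exact hφ.isUnit_iff.2 hu
    · rw [hφ.isUnit_iff, hy', QuadraticAlgebra.norm_star] at hu
      exact hφ.isUnit_iff.2 hu

theorem isUnit_of_not_dvd_norm {D : Type u} [CommRing D] {a b p : ℤ}
    {φ : D →+* QuadraticAlgebra ℤ a b} (hφ : IsOrderEmbedding p φ) (hp : Prime p) {x y : D}
    (hxy : (p : D) = x * y) (hx : ¬ p ∣ norm (φ x)) : IsUnit x := by
  have hN : p ^ 2 = norm (φ x) * norm (φ y) := by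
    rw [← map_mul, ← map_mul, ← hxy, map_intCast, norm_intCast]; rfl
  have hu : IsUnit (norm (φ x)) := by
    refine (((hp.coprime_iff_not_dvd).2 hx).symm.pow_right (n := 2)).isUnit_of_dvd' dvd_rfl ?_
    exact ⟨_, hN⟩
  rw [hφ.isUnit_iff]
  have := norm_nonneg_of_disc_neg hφ.disc_neg (φ x)
  rcases Int.isUnit_iff.1 hu with h | h <;> omega

/-- In a factorization of `p` into non-units both norms are divisible by `p`, so both factors are
multiples of `p` in `ℤ[ω]`, and their product is a multiple of `p²`. -/
theorem irreducible_intCast {D : Type u} [CommRing D] {a b p : ℤ}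
    {φ : D →+* QuadraticAlgebra ℤ a b} (hφ : IsOrderEmbedding p φ) (hp : Prime p) :
    Irreducible (p : D) := by
  refine ⟨fun hu => hp.not_isUnit ?_, fun x y hxy => ?_⟩
  · rw [hφ.isUnit_iff, map_intCast, norm_intCast] at hu
    exact IsUnit.of_mul_eq_one p (by simpa [sq] using hu)
  · by_contra! hcon
    have hx : p ∣ norm (φ x) := by
      by_contra h
      exact hcon.1 (hφ.isUnit_of_not_dvd_norm hp hxy h)
    have hy : p ∣ norm (φ y) := by
      by_contra h
      exact hcon.2 (hφ.isUnit_of_not_dvd_norm hp (by rw [hxy, mul_comm]) h)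
    obtain ⟨β, hβ⟩ := hφ.exists_eq_mul_of_dvd_norm hp hx
    obtain ⟨γ, hγ⟩ := hφ.exists_eq_mul_of_dvd_norm hp hy
    have hN : p ^ 2 = (p ^ 2 * norm β) * (p ^ 2 * norm γ) := by
      have : norm (φ (p : D)) = norm (φ x) * norm (φ y) := by rw [hxy, map_mul, map_mul]
      rw [hβ, hγ, map_intCast, map_mul, map_mul, norm_intCast] at this
      exact_mod_cast this
    have h1 : p ^ 2 * (norm β * norm γ) = 1 :=
      mul_left_cancel₀ (pow_ne_zero 2 hp.ne_zero) (by linear_combination -hN)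
    exact hp.not_isUnit (isUnit_of_dvd_one ((dvd_pow_self p two_ne_zero).trans ⟨_, h1.symm⟩))

theorem not_irreducible_of_eq_mul {D : Type u} [CommRing D] {a b p : ℤ}
    {φ : D →+* QuadraticAlgebra ℤ a b} (hφ : IsOrderEmbedding p φ) (hp : Prime p)
    (hD : IsIDPD D) {α : QuadraticAlgebra ℤ a b} (h0 : α ≠ 0) (hα : ¬ IsUnit α) {d : D}
    (hd : φ d = (p : QuadraticAlgebra ℤ a b) * α) : ¬ Irreducible d := by
  intro hirr
  have := hD.isDomain
  obtain ⟨e, he⟩ := hφ.exists_star d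
  have hde := hφ.mul_of_eq_star he
  have hNα := norm_pos_of_disc_neg hφ.disc_neg h0
  rw [isUnit_iff_norm_eq_one hφ.disc_neg] at hα
  have hN : norm (φ d) = p ^ 2 * norm α := by rw [hd, map_mul, norm_intCast]; rfl
  have hNα0 : ((norm α : ℤ) : D) ≠ 0 := by
    intro h
    have := congrArg (fun x => (φ x).re) h
    simp at this
    omega
  obtain ⟨s, hs, hsα⟩ := hD.exists_multiset_associated hNα0
  have hpirr := hφ.irreducible_intCast hp
  -- Both lists factor `p² N(α)`: conjugate irreducibles on one side, `p`, `p` and the factors of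
  -- `N(α)` on the other. Equal length forces `N(α)` to be a unit.
  have hcard := hD.card_eq_card {d, e} ((p : D) ::ₘ (p : D) ::ₘ s)
    (by simpa using ⟨hirr, hφ.irreducible_of_eq_star he hirr⟩)
    (by simpa using ⟨hpirr, hs⟩) (by
      simp only [Multiset.insert_eq_cons, Multiset.prod_cons, Multiset.prod_singleton]
      rw [hde, hN]
      push_cast
      rw [sq, mul_assoc]
      exact (hsα.symm.mul_left _).mul_left _)
  have hs0 : s = 0 := by simpa using hcard
  rw [hs0, Multiset.prod_zero] at hsα
  have hu := associated_one_iff_isUnit.1 hsα.symm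
  rw [hφ.isUnit_iff, map_intCast, norm_intCast] at hu
  have hu' : norm α ^ 2 = 1 := by exact_mod_cast hu
  rcases sq_eq_one_iff.1 hu' with h | h <;> omega

/-- In an irreducible divisor pair domain `ℤ + pℤω`, every element of `ℤ[ω]` is a unit multiple of
an element of `ℤ + pℤω`. -/
theorem exists_isUnit_mul {D : Type u} [CommRing D] {a b p : ℤ}
    {φ : D →+* QuadraticAlgebra ℤ a b} (hφ : IsOrderEmbedding p φ) (hp : Prime p)
    (hD : IsIDPD D) (α : QuadraticAlgebra ℤ a b) :
    ∃ u d, IsUnit u ∧ α = u * φ d := by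
  have := hD.isDomain
  have := isDomain_of_disc_neg hφ.disc_neg
  have hpR : (p : QuadraticAlgebra ℤ a b) ≠ 0 := by
    intro h
    exact hp.ne_zero (by simpa using congrArg re h)
  induction hn : (norm α).natAbs using Nat.strong_induction_on generalizing α with
  | _ n ih =>
  by_cases h0 : α = 0
  · exact ⟨1, 0, isUnit_one, by simp [h0]⟩
  by_cases hu : IsUnit α
  · exact ⟨α, 1, hu, by simp⟩
  by_cases hα : p ∣ α.im
  · obtain ⟨d, rfl⟩ := (hφ.exists_iff α).2 hα
    exact ⟨1, d, isUnit_one, by simp⟩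
  obtain ⟨d, hd⟩ := (hφ.exists_iff ((p : QuadraticAlgebra ℤ a b) * α)).2 (by simp)
  have hirr := hφ.not_irreducible_of_eq_mul hp hD h0 hu hd
  have hdu : ¬ IsUnit d := fun h => hp.not_isUnit (by
    have := isUnit_of_mul_isUnit_left (hd ▸ h.map φ)
    rw [isUnit_iff_norm_eq_one hφ.disc_neg, norm_intCast] at this
    exact IsUnit.of_mul_eq_one p (by simpa [sq] using this))
  -- A factor of `pα` with norm divisible by `p` absorbs the `p`, so the other factor `y`, a
  -- non-unit of `D`, divides `α` with a cofactor of smaller norm.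
  have key : ∀ x y : D, d = x * y → ¬ IsUnit y → p ∣ norm (φ x) →
      ∃ u d, IsUnit u ∧ α = u * φ d := by
    intro x y hxy hy hx
    obtain ⟨β, hβ⟩ := hφ.exists_eq_mul_of_dvd_norm hp hx
    have hαβ : α = β * φ y := by
      apply mul_left_cancel₀ hpR
      rw [← hd, hxy, map_mul, hβ, mul_assoc]
    have hy0 : y ≠ 0 := by rintro rfl; simp [hαβ] at h0
    have hβ0 : β ≠ 0 := by rintro rfl; simp [hαβ] at h0
    have h1 := hφ.one_lt_norm hy0 hy
    have h2 := norm_pos_of_disc_neg hφ.disc_neg hβ0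
    obtain ⟨u, e, hu, he⟩ := ih (norm β).natAbs (by
      rw [← hn, hαβ, map_mul]
      exact Int.natAbs_lt_natAbs_of_nonneg_of_lt h2.le (by nlinarith)) β rfl
    exact ⟨u, e * y, hu, by rw [hαβ, he, map_mul, mul_assoc]⟩
  rw [irreducible_iff] at hirr
  push Not at hirr
  obtain ⟨x, y, hxy, hx, hy⟩ := hirr hdu
  have hdvd : p ∣ norm (φ x) * norm (φ y) := by
    rw [← map_mul, ← map_mul, ← hxy, hd, map_mul, norm_intCast]
    exact Dvd.dvd.mul_right (dvd_pow_self p two_ne_zero) _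
  rcases hp.dvd_or_dvd hdvd with h | h
  · exact key x y hxy hy h
  · exact key y x (by rw [hxy, mul_comm]) hx h

theorem exists_norm_eq {D : Type u} [CommRing D] {a b p : ℤ}
    {φ : D →+* QuadraticAlgebra ℤ a b} (hφ : IsOrderEmbedding p φ) (hp : Prime p)
    (hD : IsIDPD D) (α : QuadraticAlgebra ℤ a b) :
    ∃ x y : ℤ, 4 * norm α = (2 * x + b * (p * y)) ^ 2 - (b ^ 2 + 4 * a) * (p * y) ^ 2 := by
  obtain ⟨u, d, hu, rfl⟩ := hφ.exists_isUnit_mul hp hD α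
  obtain ⟨y, hy⟩ := hφ.dvd_im d
  refine ⟨(φ d).re, y, ?_⟩
  rw [map_mul, (isUnit_iff_norm_eq_one hφ.disc_neg).1 hu, one_mul, four_mul_norm, hy]

/-- In the formula of `exists_norm_eq`, any `y ≠ 0` would contribute at least `-(b² + 4a)p²`; so `y
= 0`. -/
theorem exists_norm_eq_sq {D : Type u} [CommRing D] {a b p : ℤ}
    {φ : D →+* QuadraticAlgebra ℤ a b} (hφ : IsOrderEmbedding p φ) (hp : Prime p)
    (hD : IsIDPD D) (α : QuadraticAlgebra ℤ a b)
    (hα : 4 * norm α < - (b ^ 2 + 4 * a) * p ^ 2) : ∃ x : ℤ, norm α = x ^ 2 := by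
  obtain ⟨x, y, hxy⟩ := hφ.exists_norm_eq hp hD α
  have hneg := hφ.disc_neg
  have hy : y = 0 := by
    by_contra hy
    have : 1 ≤ y ^ 2 := by have : 0 < y ^ 2 := by positivity
                           omega
    have h1 : - (b ^ 2 + 4 * a) * p ^ 2 * 1 ≤ - (b ^ 2 + 4 * a) * p ^ 2 * y ^ 2 :=
      mul_le_mul_of_nonneg_left this (mul_nonneg (by omega) (sq_nonneg p))
    nlinarith [sq_nonneg (2 * x + b * (p * y))]
  subst hy
  exact ⟨x, by linarith⟩

/-- If both `ω` and `1 + ω` have norm below the bound, then `-a` and `1 + b - a` are squares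
differing by `1 + b ≤ 2`, which is impossible since `-a > 0`. For `p = 2` the bound fails only for
the norm `3` of `1 + ω` at `a = -1`, `b = 1`. -/
theorem eq_of_isIDPD {D : Type u} [CommRing D] {a b p : ℤ}
    {φ : D →+* QuadraticAlgebra ℤ a b} (hφ : IsOrderEmbedding p φ) (hp : Prime p)
    (hp0 : 0 < p) (hb : b = 0 ∨ b = 1) (hD : IsIDPD D) : a = -1 ∧ b = 1 ∧ p = 2 := by
  have hneg := hφ.disc_neg
  have hp2 : 2 ≤ p := by
    have := hp.not_isUnit
    rw [Int.isUnit_iff] at this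
    omega
  have hω : norm (⟨0, 1⟩ : QuadraticAlgebra ℤ a b) = -a := by simp [norm_def]
  have hω1 : norm (⟨1, 1⟩ : QuadraticAlgebra ℤ a b) = 1 + b - a := by simp [norm_def]
  have h2 : 2 ^ 2 ≤ p ^ 2 := by gcongr
  have hΔ : -(b ^ 2 + 4 * a) * 2 ^ 2 ≤ -(b ^ 2 + 4 * a) * p ^ 2 :=
    mul_le_mul_of_nonneg_left h2 (by omega)
  by_cases hcase : a = -1 ∧ b = 1
  · obtain ⟨rfl, rfl⟩ := hcase
    refine ⟨rfl, rfl, ?_⟩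
    by_contra hne
    have h3 : 3 ^ 2 ≤ p ^ 2 := by
      have : 3 ≤ p := by omega
      gcongr
    -- Here `4 · 3 < 3 · 3²`, but `3` is not a square; with `p = 2` both sides would equal `12`.
    obtain ⟨x, hx⟩ := hφ.exists_norm_eq_sq hp hD ⟨1, 1⟩ (by rw [hω1]; linarith)
    rw [hω1] at hx
    have h1 : x < 2 := by nlinarith
    have h2 : -2 < x := by nlinarith
    interval_cases x <;> omega
  · exfalso
    obtain ⟨k, hk⟩ := hφ.exists_norm_eq_sq hp hD ⟨0, 1⟩ (by
      rw [hω]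
      rcases hb with rfl | rfl <;> linarith)
    obtain ⟨l, hl⟩ := hφ.exists_norm_eq_sq hp hD ⟨1, 1⟩ (by
      rw [hω1]
      rcases hb with rfl | rfl <;> omega)
    rw [hω] at hk
    rw [hω1] at hl
    have hlk : |l| ^ 2 = 1 + b + |k| ^ 2 := by rw [sq_abs, sq_abs]; linarith
    have hk1 : 1 ≤ |k| := by
      refine Int.one_le_abs ?_
      rintro rfl
      rcases hb with rfl | rfl <;> omega
    have hkl : |k| < |l| := by
      apply lt_of_pow_lt_pow_left₀ 2 (abs_nonneg l)
      omega
    -- Squares of distinct positive integers differ by at least `3`.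
    have : (|k| + 1) ^ 2 ≤ |l| ^ 2 := by gcongr; omega
    rcases hb with rfl | rfl <;> nlinarith

/-! ### The model `ℤ[√-3]` and transport of isomorphisms. -/

/-- The embedding of `ℤ[√-3]` into the Eisenstein integers `ℤ[ω]`, `ω² = ω - 1`. -/
def sqrtNegThree : ℤ√(-3) →+* QuadraticAlgebra ℤ (-1) 1 :=
  Zsqrtd.lift ⟨⟨-1, 2⟩, by ext <;> simp⟩

theorem sqrtNegThree_apply (z : ℤ√(-3)) : sqrtNegThree z = ⟨z.re - z.im, 2 * z.im⟩ := by
  ext <;> simp [sqrtNegThree] <;> ring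

theorem isOrderEmbedding_sqrtNegThree : IsOrderEmbedding 2 sqrtNegThree where
  disc_neg := by norm_num
  injective x y h := by
    simp only [sqrtNegThree_apply, QuadraticAlgebra.mk.injEq] at h
    ext <;> omega
  exists_iff z := by
    refine ⟨?_, ?_⟩
    · rintro ⟨d, rfl⟩
      simp [sqrtNegThree_apply]
    · rintro ⟨y, hy⟩
      exact ⟨⟨z.re + y, y⟩, by ext <;> simp [sqrtNegThree_apply, hy]⟩

/-- The two embeddings have the same image, cut out by `p ∣ z.im`. -/
theorem nonempty_ringEquiv {D E : Type*} [CommRing D] [CommRing E] {a b p : ℤ}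
    {φ : D →+* QuadraticAlgebra ℤ a b} {ψ : E →+* QuadraticAlgebra ℤ a b}
    (hφ : IsOrderEmbedding p φ) (hψ : IsOrderEmbedding p ψ) : Nonempty (D ≃+* E) := by
  have h : φ.range = ψ.range := by
    ext z
    rw [RingHom.mem_range, RingHom.mem_range, hφ.exists_iff, hψ.exists_iff]
  exact ⟨(RingEquiv.ofBijective φ.rangeRestrict
      ⟨fun _ _ h => hφ.injective (congrArg Subtype.val h), φ.rangeRestrict_surjective⟩).trans
    ((RingEquiv.subringCongr h).trans (RingEquiv.ofBijective ψ.rangeRestrict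
      ⟨fun _ _ h => hψ.injective (congrArg Subtype.val h), ψ.rangeRestrict_surjective⟩).symm)⟩

theorem nonempty_ringEquiv_of_isIDPD {D : Type u} [CommRing D] {a b p : ℤ}
    {φ : D →+* QuadraticAlgebra ℤ a b} (hφ : IsOrderEmbedding p φ) (hp : Prime p)
    (hp0 : 0 < p) (hb : b = 0 ∨ b = 1) (hD : IsIDPD D) : Nonempty (D ≃+* ℤ√(-3)) := by
  obtain ⟨rfl, rfl, rfl⟩ := hφ.eq_of_isIDPD hp hp0 hb hD
  exact hφ.nonempty_ringEquiv isOrderEmbedding_sqrtNegThree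

end IsOrderEmbedding

/-! ### Structure of orders in quadratic fields. -/

open Polynomial in
theorem exists_sq_eq_of_isIntegral {K : Type u} [Field K] [NumberField K]
    (hK : Module.finrank ℚ K = 2) {τ : K} (hτ : IsIntegral ℤ τ) :
    ∃ a b : ℤ, τ ^ 2 = a + b * τ := by
  have hdeg : (minpoly ℤ τ).natDegree ≤ 2 := by
    have h1 := minpoly.natDegree_le (A := ℚ) τ
    rwa [hK, minpoly.isIntegrallyClosed_eq_field_fractions' ℚ hτ,
      (minpoly.monic hτ).natDegree_map] at h1
  -- The power of `X` raises the degree to exactly `2`, so rational `τ` needs no separate case.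
  have hmon : (X ^ (2 - (minpoly ℤ τ).natDegree) * minpoly ℤ τ).Monic :=
    (monic_X_pow _).mul (minpoly.monic hτ)
  have hnat : (X ^ (2 - (minpoly ℤ τ).natDegree) * minpoly ℤ τ).natDegree = 2 := by
    rw [(monic_X_pow _).natDegree_mul (minpoly.monic hτ), natDegree_X_pow]
    omega
  have hroot : aeval τ (X ^ (2 - (minpoly ℤ τ).natDegree) * minpoly ℤ τ) = 0 := by
    rw [map_mul, minpoly.aeval, mul_zero]
  generalize X ^ (2 - (minpoly ℤ τ).natDegree) * minpoly ℤ τ = P at *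
  have hlead : P.coeff 2 = 1 := by rw [← hnat]; exact hmon
  rw [aeval_eq_sum_range, hnat, Finset.sum_range_succ, Finset.sum_range_succ,
    Finset.sum_range_one, hlead] at hroot
  refine ⟨-P.coeff 0, -P.coeff 1, ?_⟩
  simp only [zsmul_eq_mul, Int.cast_one] at hroot
  push_cast
  linear_combination hroot

theorem exists_intCast_eq_of_isIntegral {K : Type u} [Field K] [CharZero K] {r : ℚ}
    (hr : IsIntegral ℤ (algebraMap ℚ K r)) : ∃ n : ℤ, r = n := by
  have := (isIntegral_algebraMap_iff (R := ℤ) (algebraMap ℚ K).injective).1 hr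
  obtain ⟨n, hn⟩ := IsIntegrallyClosed.isIntegral_iff.1 this
  exact ⟨n, by simpa using hn.symm⟩

theorem exists_linearMap_ker {K : Type u} [Field K] [NumberField K]
    (hK : Module.finrank ℚ K = 2) :
    ∃ f : K →ₗ[ℚ] ℚ, ∀ x, f x = 0 → ∃ r : ℚ, x = algebraMap ℚ K r := by
  have h1 : Module.finrank ℚ (K ⧸ Submodule.span ℚ {(1 : K)}) = Module.finrank ℚ ℚ := by
    have := Submodule.finrank_quotient_add_finrank (Submodule.span ℚ {(1 : K)})
    rw [finrank_span_singleton one_ne_zero, hK] at this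
    rw [Module.finrank_self]
    omega
  let e := LinearEquiv.ofFinrankEq (K ⧸ Submodule.span ℚ {(1 : K)}) ℚ h1
  refine ⟨e.toLinearMap ∘ₗ Submodule.mkQ _, fun x hx => ?_⟩
  simp only [LinearMap.comp_apply, LinearEquiv.coe_coe, EmbeddingLike.map_eq_zero_iff,
    Submodule.mkQ_apply, Submodule.Quotient.mk_eq_zero, Submodule.mem_span_singleton] at hx
  obtain ⟨r, rfl⟩ := hx
  exact ⟨r, Algebra.smul_def r 1 |>.trans (mul_one _)⟩

namespace IsNumberFieldOrder

theorem isIntegral {K : Type u} [Field K] [NumberField K] {O : Subring K}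
    (hO : IsNumberFieldOrder O) {x : K} (hx : x ∈ O) : IsIntegral ℤ x := by
  have := hO.finite
  exact (Algebra.IsIntegral.isIntegral (R := ℤ) (⟨x, hx⟩ : O)).map O.subtype.toIntAlgHom

theorem exists_mul_mem {K : Type u} [Field K] [NumberField K] {O : Subring K}
    (hO : IsNumberFieldOrder O) (x : K) : ∃ m : ℕ, 0 < m ∧ (m : K) * x ∈ O := by
  have hx : x ∈ Submodule.span ℚ (O : Set K) := hO.span_eq_top ▸ Submodule.mem_top
  induction hx using Submodule.span_induction with
  | mem x hx => exact ⟨1, one_pos, by simpa using hx⟩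
  | zero => exact ⟨1, one_pos, by simp⟩
  | add x y _ _ hx hy =>
    obtain ⟨m, hm, hmx⟩ := hx
    obtain ⟨n, hn, hny⟩ := hy
    refine ⟨m * n, by positivity, ?_⟩
    have := O.add_mem (O.mul_mem (natCast_mem O n) hmx) (O.mul_mem (natCast_mem O m) hny)
    convert this using 1
    push_cast
    ring
  | smul r x _ hx =>
    obtain ⟨m, hm, hmx⟩ := hx
    refine ⟨m * r.den, Nat.mul_pos hm r.den_pos, ?_⟩
    have := O.mul_mem (intCast_mem O r.num) hmx
    convert this using 1
    have hr : (r.den : K) * algebraMap ℚ K r = r.num := by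
      rw [← map_natCast (algebraMap ℚ K), ← map_mul, Rat.den_mul_eq_num, map_intCast]
    rw [Algebra.smul_def]
    push_cast
    linear_combination (m * x) * hr

theorem exists_isIntegral_notMem {K : Type u} [Field K] [NumberField K] {O : Subring K}
    (hO : IsNumberFieldOrder O) (h : ¬ IsIntegrallyClosed O) :
    ∃ x : K, IsIntegral ℤ x ∧ x ∉ O := by
  have hfrac : IsFractionRing O K := by
    refine IsFractionRing.of_field O K fun z => ?_
    obtain ⟨m, hm, hmz⟩ := hO.exists_mul_mem z
    refine ⟨⟨_, hmz⟩, m, ?_⟩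
    have : (m : K) ≠ 0 := by exact_mod_cast hm.ne'
    rw [map_natCast, eq_div_iff this, mul_comm]
    rfl
  have := hO.finite
  by_contra! hcon
  refine h ((isIntegrallyClosed_iff K).2 fun {x} hx => ?_)
  exact ⟨⟨x, hcon x (isIntegral_trans x hx)⟩, rfl⟩

/-- The image `f(O)` is a finitely generated subgroup of `ℚ`, hence cyclic, generated by some `f σ`.
Subtracting a multiple of `σ` leaves a rational integral element, that is, an integer. -/
theorem exists_generator {K : Type u} [Field K] [NumberField K] {O : Subring K}
    (hO : IsNumberFieldOrder O) {f : K →ₗ[ℚ] ℚ}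
    (hf : ∀ x, f x = 0 → ∃ r : ℚ, x = algebraMap ℚ K r) :
    ∃ σ ∈ O, ∀ x ∈ O, ∃ m n : ℤ, x = m + n * σ := by
  have := hO.finite
  let g : O →ₗ[ℤ] ℚ := (f.toAddMonoidHom.comp O.subtype.toAddMonoidHom).toIntLinearMap
  have hg : ∀ x : O, g x = f x := fun _ => rfl
  have hfg : (LinearMap.range g).FG := Module.Finite.iff_fg.1 inferInstance
  have hpr : (LinearMap.range g).IsPrincipal :=
    FractionalIdeal.isPrincipal
      (⟨LinearMap.range g, FractionalIdeal.isFractional_of_fg hfg⟩ :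
        FractionalIdeal (nonZeroDivisors ℤ) ℚ)
  obtain ⟨c, hc⟩ := hpr.principal
  obtain ⟨σ, rfl⟩ : c ∈ LinearMap.range g := hc ▸ Submodule.mem_span_singleton_self c
  refine ⟨σ, σ.2, fun x hx => ?_⟩
  obtain ⟨n, hn⟩ := Submodule.mem_span_singleton.1
    (hc ▸ LinearMap.mem_range_self g ⟨x, hx⟩ : g ⟨x, hx⟩ ∈ Submodule.span ℤ {g σ})
  rw [hg, hg, zsmul_eq_mul] at hn
  have h0 : f (x - n * σ) = 0 := by
    rw [← zsmul_eq_mul, map_sub, map_zsmul, zsmul_eq_mul, hn, sub_self]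
  obtain ⟨r, hr⟩ := hf _ h0
  obtain ⟨m, rfl⟩ := exists_intCast_eq_of_isIntegral (K := K) (r := r) (by
    rw [← hr]
    exact hO.isIntegral (O.sub_mem hx (O.mul_mem (intCast_mem O n) σ.2)))
  refine ⟨m, n, ?_⟩
  rw [map_intCast] at hr
  linear_combination hr

theorem exists_prime_mul_mem {K : Type u} [Field K] [NumberField K] {O : Subring K}
    (hO : IsNumberFieldOrder O) (h : ¬ IsIntegrallyClosed O) :
    ∃ p : ℕ, p.Prime ∧ ∃ x : K, IsIntegral ℤ x ∧ x ∉ O ∧ (p : K) * x ∈ O := by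
  obtain ⟨x, hx, hxO⟩ := hO.exists_isIntegral_notMem h
  have hex := hO.exists_mul_mem x
  classical
  obtain ⟨hm, hmx⟩ := Nat.find_spec hex
  have hmin := fun n => Nat.find_min hex (m := n)
  generalize Nat.find hex = m at *
  -- For minimal `m` with `m x ∈ O` and a prime `p ∣ m`, the element `(m / p) x` lies outside `O`
  -- but is carried into it by `p`.
  have hm1 : m ≠ 1 := by rintro rfl; exact hxO (by simpa using hmx)
  obtain ⟨k, hk⟩ := m.minFac_dvd
  have hp := Nat.minFac_prime hm1
  generalize m.minFac = p at *
  subst hk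
  have hk0 : 0 < k := Nat.pos_of_mul_pos_left hm
  refine ⟨p, hp, k * x, ?_, ?_, ?_⟩
  · exact (map_natCast (algebraMap ℤ K) k ▸ isIntegral_algebraMap : IsIntegral ℤ (k : K)).mul hx
  · exact fun hkx => hmin k (by nlinarith [hp.two_le]) ⟨hk0, hkx⟩
  · rw [← mul_assoc]; exact_mod_cast hmx

/-- An order in a quadratic field that is not integrally closed has the form `ℤ + pℤτ` for a prime
`p` and an integral element `τ`. -/
theorem exists_eq_add_prime_mul {K : Type u} [Field K] [NumberField K] {O : Subring K}
    (hO : IsNumberFieldOrder O) (hK : Module.finrank ℚ K = 2) (h : ¬ IsIntegrallyClosed O) :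
    ∃ p : ℕ, p.Prime ∧ ∃ τ : K, IsIntegral ℤ τ ∧
      ∀ x, x ∈ O ↔ ∃ m n : ℤ, x = m + n * (p * τ) := by
  obtain ⟨f, hf⟩ := exists_linearMap_ker hK
  obtain ⟨σ, hσ, hgen⟩ := hO.exists_generator hf
  obtain ⟨p, hp, y, hy, hyO, hpy⟩ := hO.exists_prime_mul_mem h
  obtain ⟨k, l, hkl⟩ := hgen _ hpy
  have hp0 : (p : K) ≠ 0 := by exact_mod_cast hp.ne_zero
  have hint : ∀ n : ℤ, IsIntegral ℤ (n : K) := fun n => isIntegral_algebraMap (R := ℤ) (x := n)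
  -- If `l = pc`, then `y - cσ = k / p` is rational and integral, hence an integer, and `y ∈ O`.
  have hpl : ¬ (p : ℤ) ∣ l := by
    rintro ⟨c, rfl⟩
    have hyc : y - c * σ = algebraMap ℚ K (k / p) := by
      rw [map_div₀, map_intCast, map_natCast, eq_div_iff hp0]
      push_cast at hkl
      linear_combination hkl
    obtain ⟨n, hn⟩ := exists_intCast_eq_of_isIntegral (K := K) (r := k / p) (by
      rw [← hyc]
      exact hy.sub ((hint c).mul (hO.isIntegral hσ)))
    rw [hn, map_intCast] at hyc
    refine hyO ?_
    rw [show y = n + c * σ by linear_combination hyc]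
    exact O.add_mem (intCast_mem O n) (O.mul_mem (intCast_mem O c) hσ)
  -- Bézout: with `up + vl = 1`, the element `τ = vy + uσ` satisfies `pτ = vk + σ`, so `pτ` can
  -- replace `σ` as generator.
  obtain ⟨u, v, huv⟩ := ((Nat.prime_iff_prime_int.1 hp).coprime_iff_not_dvd).2 hpl
  have huv' : (u : K) * p + v * l = 1 := by exact_mod_cast huv
  have hτ : p * (v * y + u * σ) = v * k + σ := by
    linear_combination v * hkl + σ * huv'
  refine ⟨p, hp, v * y + u * σ, ((hint v).mul hy).add ((hint u).mul (hO.isIntegral hσ)),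
    fun x => ⟨fun hx => ?_, ?_⟩⟩
  · obtain ⟨m, n, rfl⟩ := hgen x hx
    refine ⟨m - n * (v * k), n, ?_⟩
    rw [hτ]
    push_cast
    ring
  · rintro ⟨m, n, rfl⟩
    rw [hτ]
    exact O.add_mem (intCast_mem O m) (O.mul_mem (intCast_mem O n)
      (O.add_mem (O.mul_mem (intCast_mem O v) (intCast_mem O k)) hσ))

theorem exists_eq_add_prime_mul_reduced {K : Type u} [Field K] [NumberField K] {O : Subring K}
    (hO : IsNumberFieldOrder O) (hK : Module.finrank ℚ K = 2) (h : ¬ IsIntegrallyClosed O) :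
    ∃ p : ℕ, p.Prime ∧ ∃ (τ : K) (a b : ℤ), τ ^ 2 = a + b * τ ∧ (b = 0 ∨ b = 1) ∧
      ∀ x, x ∈ O ↔ ∃ m n : ℤ, x = m + n * (p * τ) := by
  obtain ⟨p, hp, τ, hτ, hmem⟩ := hO.exists_eq_add_prime_mul hK h
  obtain ⟨a, b, hab⟩ := exists_sq_eq_of_isIntegral hK hτ
  -- Translating `τ` by `k = ⌊b/2⌋` leaves `b mod 2` as the linear coefficient.
  obtain ⟨k, hk⟩ : ∃ k, b - 2 * k = 0 ∨ b - 2 * k = 1 := ⟨b / 2, by omega⟩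
  refine ⟨p, hp, τ - k, a + b * k - k ^ 2, b - 2 * k, ?_, hk, fun x => (hmem x).trans ⟨?_, ?_⟩⟩
  · push_cast
    linear_combination hab
  · rintro ⟨m, n, rfl⟩
    exact ⟨m + n * p * k, n, by push_cast; ring⟩
  · rintro ⟨m, n, rfl⟩
    exact ⟨m - n * p * k, n, by push_cast; ring⟩

end IsNumberFieldOrder

/-! ### Embedding a non-maximal imaginary quadratic order into `ℤ[ω]`. -/

theorem IsImaginaryQuadraticField.disc_neg {K : Type u} [Field K] [NumberField K]
    (hK : IsImaginaryQuadraticField K) {τ : K} {a b : ℤ} (hτ : τ ^ 2 = a + b * τ)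
    (hgen : ∀ x : K, ∃ r s : ℚ, x = algebraMap ℚ K r + algebraMap ℚ K s * τ) :
    b ^ 2 + 4 * a < 0 := by
  by_contra! hneg
  have := hK.isTotallyComplex
  let φ : K →+* ℂ := Classical.arbitrary _
  have h2 : (2 * φ τ - b) ^ 2 = ((b ^ 2 + 4 * a : ℤ) : ℂ) := by
    have := congrArg φ hτ
    simp only [map_pow, map_add, map_mul, map_intCast] at this
    push_cast
    linear_combination 4 * this
  -- A complex number whose square is a non-negative real is itself real. As `τ` generates `K`, the
  -- whole embedding is then real.
  have him : (φ τ).im = 0 := by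
    have hre := congrArg Complex.re h2
    have him := congrArg Complex.im h2
    simp only [sq, Complex.mul_re, Complex.mul_im, Complex.sub_re, Complex.sub_im,
      Complex.intCast_re, Complex.intCast_im, Complex.re_ofNat, Complex.im_ofNat] at hre him
    have hneg' : (0 : ℝ) ≤ ((b * b + 4 * a : ℤ) : ℝ) := by
      exact_mod_cast (by linarith [sq b] : 0 ≤ b * b + 4 * a)
    by_contra hne
    have hz : 2 * (φ τ).re - b = 0 := by
      have : (φ τ).im * (2 * (φ τ).re - b) = 0 := by linarith
      exact (mul_eq_zero.1 this).resolve_left hne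
    have : 0 < (φ τ).im ^ 2 := by positivity
    nlinarith
  refine NumberField.IsTotallyComplex.complexEmbedding_not_isReal φ ?_
  rw [NumberField.ComplexEmbedding.isReal_iff]
  ext x
  obtain ⟨r, s, rfl⟩ := hgen x
  have hconj : (starRingEnd ℂ) (φ τ) = φ τ := Complex.conj_eq_iff_im.2 him
  simp [NumberField.ComplexEmbedding.conjugate_coe_eq, hconj]

theorem IsNumberFieldOrder.exists_isOrderEmbedding {K : Type u} [Field K] [NumberField K]
    {O : Subring K} (hO : IsNumberFieldOrder O) (hK : IsImaginaryQuadraticField K)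
    (h : ¬ IsIntegrallyClosed O) :
    ∃ p : ℕ, p.Prime ∧ ∃ (a b : ℤ) (φ : O →+* QuadraticAlgebra ℤ a b),
      (b = 0 ∨ b = 1) ∧ IsOrderEmbedding p φ := by
  obtain ⟨p, hp, τ, a, b, hτ, hb, hmem⟩ := hO.exists_eq_add_prime_mul_reduced hK.finrank_eq_two h
  have hgen : ∀ x : K, ∃ r s : ℚ, x = algebraMap ℚ K r + algebraMap ℚ K s * τ := by
    intro x
    obtain ⟨k, hk, hkx⟩ := hO.exists_mul_mem x
    obtain ⟨m, n, hmn⟩ := (hmem _).1 hkx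
    have hk0 : (k : K) ≠ 0 := by exact_mod_cast hk.ne'
    refine ⟨m / k, n * p / k, ?_⟩
    simp only [map_div₀, map_mul, map_intCast, map_natCast]
    field_simp
    linear_combination hmn
  have hirr : ∀ q : ℚ, τ ≠ algebraMap ℚ K q := by
    rintro q rfl
    have := finrank_le_one (R := ℚ) (1 : K) fun w => by
      obtain ⟨r, s, rfl⟩ := hgen w
      exact ⟨r + s * q, by rw [Algebra.smul_def, mul_one, map_add, map_mul]⟩
    rw [hK.finrank_eq_two] at this
    omega
  let ψ : QuadraticAlgebra ℤ a b →ₐ[ℤ] K := QuadraticAlgebra.lift ⟨τ, by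
    simp only [zsmul_eq_mul, mul_one]
    rw [← sq, hτ]⟩
  have hψ : ∀ z, ψ z = z.re + z.im * τ := fun z => by
    simp [ψ, QuadraticAlgebra.lift]
  have hinj : Function.Injective ψ := by
    rw [injective_iff_map_eq_zero]
    intro z hz
    rw [hψ] at hz
    have him : z.im = 0 := by
      by_contra hne
      have hne' : (z.im : K) ≠ 0 := by exact_mod_cast hne
      refine hirr (-z.re / z.im) ?_
      rw [map_div₀, map_neg, map_intCast, map_intCast, eq_div_iff hne']
      linear_combination hz
    have hre : z.re = 0 := by simpa [him] using hz
    ext <;> simp [hre, him]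
  have hle : ∀ x : O, (x : K) ∈ ψ.toRingHom.range := by
    rintro ⟨x, hx⟩
    obtain ⟨m, n, rfl⟩ := (hmem x).1 hx
    refine ⟨⟨m, n * p⟩, ?_⟩
    refine (hψ _).trans ?_
    push_cast
    ring
  let e : QuadraticAlgebra ℤ a b ≃+* ψ.toRingHom.range := RingEquiv.ofBijective
    ψ.toRingHom.rangeRestrict
    ⟨fun _ _ hxy => hinj (congrArg Subtype.val hxy), ψ.toRingHom.rangeRestrict_surjective⟩
  -- `ψ` embeds `ℤ[ω]` in `K` with `O` inside its image; `φ` is the inverse of `ψ` on `O`.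
  let φ : O →+* QuadraticAlgebra ℤ a b :=
    e.symm.toRingHom.comp (O.subtype.codRestrict ψ.toRingHom.range hle)
  have hφ : ∀ x : O, ψ (φ x) = x := fun x => congrArg Subtype.val (e.apply_symm_apply ⟨x, hle x⟩)
  refine ⟨p, hp, a, b, φ, hb, hK.disc_neg hτ hgen, fun x y hxy => ?_, fun z => ⟨?_, ?_⟩⟩
  · exact Subtype.ext (by rw [← hφ x, ← hφ y, hxy])
  · rintro ⟨x, rfl⟩
    obtain ⟨m, n, hmn⟩ := (hmem x).1 x.2
    have : φ x = ⟨m, n * p⟩ := hinj (by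
      rw [hφ, hmn, hψ]
      push_cast
      ring)
    rw [this]
    exact dvd_mul_left _ _
  · rintro ⟨n, hn⟩
    refine ⟨⟨ψ z, (hmem _).2 ⟨z.re, n, ?_⟩⟩, hinj (hφ _)⟩
    rw [hψ, hn]
    push_cast
    ring

theorem IsOrderEmbedding.comp_ringEquiv {D E : Type*} [CommRing D] [CommRing E] {a b p : ℤ}
    {φ : E →+* QuadraticAlgebra ℤ a b} (hφ : IsOrderEmbedding p φ) (e : D ≃+* E) :
    IsOrderEmbedding p (φ.comp e.toRingHom) where
  disc_neg := hφ.disc_neg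
  injective := hφ.injective.comp e.injective
  exists_iff z := (hφ.exists_iff z).symm.trans
    ⟨fun ⟨x, hx⟩ => ⟨e.symm x, by simpa using hx⟩, fun ⟨x, hx⟩ => ⟨e x, hx⟩⟩ |>.symm

theorem IsIDPD.nonempty_ringEquiv {D : Type u} [CommRing D] (hD : IsIDPD D)
    (hq : IsImaginaryQuadraticOrder D) (h : ¬ IsIntegrallyClosed D) :
    Nonempty (D ≃+* ℤ√(-3)) := by
  obtain ⟨K, _, _, hK, O, hO, ⟨e⟩⟩ := hq
  obtain ⟨p, hp, a, b, φ, hb, hφ⟩ := hO.exists_isOrderEmbedding hK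
    fun hc => h (IsIntegrallyClosed.of_equiv e.symm)
  exact (hφ.comp_ringEquiv e).nonempty_ringEquiv_of_isIDPD (Nat.prime_iff_prime_int.1 hp)
    (by exact_mod_cast hp.pos) hb hD

/-! ### Eisenstein integers: Euclidean division and the prime `2`. -/

namespace QuadraticAlgebra

theorem eisenstein_norm_mul_bound {r s n : ℤ} (hn : 0 < n) (hr : |r| * 2 ≤ n) (hs : |s| * 2 ≤ n) :
    r ^ 2 + r * s + s ^ 2 < n ^ 2 := by
  have h1 : r * s ≤ |r| * |s| := (le_abs_self _).trans (abs_mul r s).le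
  have h2 : r ^ 2 = |r| ^ 2 := (sq_abs r).symm
  have h3 : s ^ 2 = |s| ^ 2 := (sq_abs s).symm
  have h4 := abs_nonneg r
  have h5 := abs_nonneg s
  rw [h2, h3]
  nlinarith

theorem exists_two_mul_abs_sub_le (m : ℤ) {n : ℤ} (hn : 0 < n) : ∃ k, |m - n * k| * 2 ≤ n := by
  refine ⟨(2 * m + n) / (2 * n), ?_⟩
  have h1 := Int.mul_ediv_add_emod (2 * m + n) (2 * n)
  have h2 := Int.emod_nonneg (2 * m + n) (by omega : 2 * n ≠ 0)
  have h3 := Int.emod_lt_of_pos (2 * m + n) (by omega : 0 < 2 * n)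
  generalize (2 * m + n) / (2 * n) = k at *
  generalize (2 * m + n) % (2 * n) = r at *
  rcases abs_cases (m - n * k) with ⟨h, -⟩ | ⟨h, -⟩ <;> rw [h] <;> nlinarith

theorem exists_norm_sub_mul_lt (x : QuadraticAlgebra ℤ (-1) 1) {y : QuadraticAlgebra ℤ (-1) 1}
    (hy : y ≠ 0) : ∃ q, norm (x - y * q) < norm y := by
  have hn := norm_pos_of_disc_neg (by norm_num) hy
  obtain ⟨k, hk⟩ := exists_two_mul_abs_sub_le (x * star y).re hn
  obtain ⟨l, hl⟩ := exists_two_mul_abs_sub_le (x * star y).im hn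
  refine ⟨⟨k, l⟩, ?_⟩
  have h := eisenstein_norm_mul_bound hn hk hl
  -- Multiplying by `star y` turns division by `y` into coordinatewise rounding modulo the integer
  -- `N(y)`; the bound then reads `N(x - yq) N(y) < N(y)²`.
  have hmul : (x - y * ⟨k, l⟩) * star y =
      ⟨(x * star y).re - norm y * k, (x * star y).im - norm y * l⟩ := by
    have hsy : y * star y = algebraMap ℤ _ (norm y) := (algebraMap_norm_eq_mul_star y).symm
    rw [sub_mul, mul_right_comm, hsy]
    ext <;> simp
  have hN := congrArg norm hmul
  rw [map_mul, QuadraticAlgebra.norm_star] at hN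
  refine lt_of_mul_lt_mul_right ?_ hn.le
  rw [hN, norm_def]
  linarith

/-- The Eisenstein integers are Euclidean with respect to the norm. -/
noncomputable abbrev eisensteinEuclideanDomain : EuclideanDomain (QuadraticAlgebra ℤ (-1) 1) :=
  open Classical in
  have := isDomain_of_disc_neg (a := -1) (b := 1) (by norm_num)
  { (inferInstance : CommRing (QuadraticAlgebra ℤ (-1) 1)),
    (inferInstance : Nontrivial (QuadraticAlgebra ℤ (-1) 1)) with
    quotient := fun x y => if hy : y = 0 then 0 else (exists_norm_sub_mul_lt x hy).choose
    quotient_zero := fun x => dif_pos rfl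
    remainder := fun x y =>
      x - y * if hy : y = 0 then 0 else (exists_norm_sub_mul_lt x hy).choose
    quotient_mul_add_remainder_eq := fun x y => by ring
    r := InvImage (· < ·) fun x => (norm x).natAbs
    r_wellFounded := InvImage.wf _ wellFounded_lt
    remainder_lt := fun x y hy => by
      rw [dif_neg hy]
      exact Int.natAbs_lt_natAbs_of_nonneg_of_lt (norm_nonneg_of_disc_neg (by norm_num) _)
        (exists_norm_sub_mul_lt x hy).choose_spec
    mul_left_not_lt := fun x y hy h => by
      refine absurd h (not_lt.2 ?_)
      simp only [map_mul, Int.natAbs_mul]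
      refine Nat.le_mul_of_pos_right _ (Int.natAbs_pos.2 ?_)
      exact (norm_pos_of_disc_neg (by norm_num) hy).ne' }

theorem prime_of_irreducible_eisenstein {x : QuadraticAlgebra ℤ (-1) 1} (hx : Irreducible x) :
    Prime x :=
  letI := eisensteinEuclideanDomain
  hx.prime

theorem two_dvd_iff {a b : ℤ} {z : QuadraticAlgebra ℤ a b} :
    2 ∣ z ↔ (2 : ℤ) ∣ z.re ∧ (2 : ℤ) ∣ z.im :=
  algebraMap_dvd_iff (r := (2 : ℤ)) (z := z)

/-- The form `r² + rs + s²` is even only when `r` and `s` both are. -/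
theorem two_dvd_of_two_dvd_norm {z : QuadraticAlgebra ℤ (-1) 1} (h : 2 ∣ norm z) : 2 ∣ z := by
  rw [two_dvd_iff]
  rw [norm_def] at h
  obtain ⟨x, hx | hx⟩ := Int.even_or_odd' z.re <;> obtain ⟨y, hy | hy⟩ := Int.even_or_odd' z.im <;>
    rw [hx, hy] at h ⊢ <;> ring_nf at h <;> omega

theorem prime_two_eisenstein : Prime (2 : QuadraticAlgebra ℤ (-1) 1) := by
  have h4 : norm (2 : QuadraticAlgebra ℤ (-1) 1) = 4 := by simp [norm_def]
  refine ⟨fun h => by simp [h] at h4, fun h => ?_, fun x y ⟨z, hz⟩ => ?_⟩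
  · rw [isUnit_iff_norm_eq_one (by norm_num), h4] at h
    omega
  · have hN := congrArg norm hz
    rw [map_mul, map_mul, h4] at hN
    exact (Int.prime_two.dvd_or_dvd (Dvd.intro (2 * norm z) (by linarith :
      2 * (2 * norm z) = norm x * norm y))).imp two_dvd_of_two_dvd_norm two_dvd_of_two_dvd_norm

/-- The units `1`, `ω - 1`, `ω` turn the `im` coordinate of `r + sω` into `s`, `r`, `r + s`, and one
of these is even. -/
theorem exists_isUnit_two_dvd_im (z : QuadraticAlgebra ℤ (-1) 1) :
    ∃ u, IsUnit u ∧ 2 ∣ (u * z).im := by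
  have hu : ∀ u : QuadraticAlgebra ℤ (-1) 1, norm u = 1 → IsUnit u :=
    fun u => (isUnit_iff_norm_eq_one (by norm_num)).2
  by_cases h1 : 2 ∣ z.im
  · exact ⟨1, isUnit_one, by simpa using h1⟩
  by_cases h2 : 2 ∣ z.re
  · exact ⟨⟨-1, 1⟩, hu _ (by simp [norm_def]), by simpa using h2⟩
  · exact ⟨⟨0, 1⟩, hu _ (by simp [norm_def]), by simp; omega⟩

end QuadraticAlgebra

namespace IsOrderEmbedding

open QuadraticAlgebra

theorem irreducible_of_map {D : Type u} [CommRing D] {a b p : ℤ}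
    {φ : D →+* QuadraticAlgebra ℤ a b} (hφ : IsOrderEmbedding p φ) {d : D}
    (hd : Irreducible (φ d)) : Irreducible d := by
  have hu : ∀ x, IsUnit (φ x) → IsUnit x := fun x hx =>
    hφ.isUnit_iff.2 ((isUnit_iff_norm_eq_one hφ.disc_neg).1 hx)
  refine ⟨fun h => hd.not_isUnit (h.map φ), fun x y hxy => ?_⟩
  exact (hd.isUnit_or_isUnit (by rw [hxy, map_mul])).imp (hu x) (hu y)

end IsOrderEmbedding

/-! ### The pair condition in `ℤ[√-3]`. -/

namespace SqrtNegThree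

open QuadraticAlgebra IsOrderEmbedding

theorem isUnit_of_isUnit_map {d : ℤ√(-3)} (h : IsUnit (sqrtNegThree d)) : IsUnit d :=
  isOrderEmbedding_sqrtNegThree.isUnit_iff.2
    ((isUnit_iff_norm_eq_one isOrderEmbedding_sqrtNegThree.disc_neg).1 h)

theorem exists_eq_of_two_dvd {z : QuadraticAlgebra ℤ (-1) 1} (h : 2 ∣ z) :
    ∃ d, sqrtNegThree d = z :=
  (isOrderEmbedding_sqrtNegThree.exists_iff z).2 (two_dvd_iff.1 h).2

theorem exists_eq_isUnit_mul (z : QuadraticAlgebra ℤ (-1) 1) :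
    ∃ u d, IsUnit u ∧ z = u * sqrtNegThree d := by
  obtain ⟨u, ⟨u, rfl⟩, hz⟩ := exists_isUnit_two_dvd_im z
  obtain ⟨d, hd⟩ := (isOrderEmbedding_sqrtNegThree.exists_iff _).2 hz
  exact ⟨_, d, u⁻¹.isUnit, by rw [hd, Units.inv_mul_cancel_left]⟩

/-- An element of the order outside `2ℤ[ω]` is congruent to `1` mod `2`, so multiplying by it
preserves the parity of `im`. -/
theorem exists_eq_of_mul_eq {q y : ℤ√(-3)} {w : QuadraticAlgebra ℤ (-1) 1}
    (hq : ¬ 2 ∣ sqrtNegThree q) (h : sqrtNegThree q * w = sqrtNegThree y) :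
    ∃ e, sqrtNegThree e = w := by
  refine (isOrderEmbedding_sqrtNegThree.exists_iff w).2 ?_
  rw [two_dvd_iff] at hq
  have h1 := isOrderEmbedding_sqrtNegThree.dvd_im q
  have h2 := isOrderEmbedding_sqrtNegThree.dvd_im y
  have hre : ¬ 2 ∣ (sqrtNegThree q).re := fun h => hq ⟨h, h1⟩
  rw [← h, im_mul] at h2
  have h3 : 2 ∣ (sqrtNegThree q).re * w.im := by
    rw [show (sqrtNegThree q).re * w.im = ((sqrtNegThree q).re * w.im + (sqrtNegThree q).im * w.re +
      1 * (sqrtNegThree q).im * w.im) - (sqrtNegThree q).im * (w.re + w.im) by ring]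
    exact dvd_sub h2 (h1.mul_right (w.re + w.im))
  exact (Int.prime_two.dvd_or_dvd h3).resolve_left hre

theorem irreducible_map {d : ℤ√(-3)} (hd : Irreducible d) : Irreducible (sqrtNegThree d) := by
  by_cases h2 : 2 ∣ sqrtNegThree d
  · obtain ⟨γ, hγ⟩ := h2
    obtain ⟨u, s, hu, rfl⟩ := exists_eq_isUnit_mul γ
    -- All of `2ℤ[ω]` lies in the order, so `d = (2u)s` is a factorization there; `s` must be a
    -- unit, and `d` is associated to the prime `2`.
    obtain ⟨k, hk⟩ := exists_eq_of_two_dvd (dvd_mul_right 2 u)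
    have hks : d = k * s := isOrderEmbedding_sqrtNegThree.injective (by
      rw [map_mul, hk, hγ, mul_assoc])
    have hs : IsUnit s := (hd.isUnit_or_isUnit hks).resolve_left fun hku =>
      prime_two_eisenstein.not_isUnit (isUnit_of_mul_isUnit_left (hk ▸ hku.map sqrtNegThree))
    rw [hγ]
    have := isDomain_of_disc_neg isOrderEmbedding_sqrtNegThree.disc_neg
    exact (irreducible_mul_isUnit (hu.mul (hs.map sqrtNegThree))).2 prime_two_eisenstein.irreducible
  · refine ⟨fun hu => hd.not_isUnit (isUnit_of_isUnit_map hu), fun α β hαβ => ?_⟩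
    obtain ⟨u, s, hu, rfl⟩ := exists_eq_isUnit_mul α
    obtain ⟨v, t, hv, rfl⟩ := exists_eq_isUnit_mul β
    have hst : sqrtNegThree (s * t) * (u * v) = sqrtNegThree d := by
      rw [hαβ, map_mul]; ring
    -- The product `uv` of the two units lies in the order, so it can be moved into one factor: `d =
    -- s(te)`.
    obtain ⟨e, he⟩ := exists_eq_of_mul_eq (fun h => h2 (hst ▸ h.mul_right _)) hst
    have hd' : d = s * (t * e) := isOrderEmbedding_sqrtNegThree.injective (by
      rw [← hst, ← he, ← map_mul, mul_assoc])
    refine (hd.isUnit_or_isUnit hd').imp (fun h => hu.mul (h.map _)) fun h => hv.mul ?_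
    exact (isUnit_of_mul_isUnit_left h).map _

theorem mul_dvd_of_not_associated {z p q : ℤ√(-3)} (hp : Irreducible p) (hq : Irreducible q)
    (hpz : p ∣ z) (hqz : q ∣ z) (hpq : ¬ Associated (sqrtNegThree p) (sqrtNegThree q))
    (h2 : ¬ 2 ∣ sqrtNegThree q) : p * q ∣ z := by
  have := isOrderEmbedding_sqrtNegThree.isDomain
  obtain ⟨y, rfl⟩ := hpz
  have hdvd := map_dvd sqrtNegThree hqz
  rw [map_mul] at hdvd
  obtain ⟨w, hw⟩ := ((prime_of_irreducible_eisenstein (irreducible_map hq)).dvd_or_dvd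
    hdvd).resolve_left fun h => hpq ((irreducible_map hq).associated_of_dvd
      (irreducible_map hp) h).symm
  obtain ⟨e, he⟩ := exists_eq_of_mul_eq h2 hw.symm
  refine mul_dvd_mul_left p ⟨e, isOrderEmbedding_sqrtNegThree.injective ?_⟩
  rw [hw, map_mul, he]

theorem exists_pair {z p q : ℤ√(-3)} (hz : z ≠ 0) (hp : Irreducible p) (hq : Irreducible q)
    (hpz : p ∣ z) (hqz : q ∣ z) (hpq : ¬ Associated p q) :
    ∃ p' q', Irreducible p' ∧ Irreducible q' ∧ Associated (p * p') (q * q') ∧ q * q' ∣ z := by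
  have := isOrderEmbedding_sqrtNegThree.isDomain
  have := isDomain_of_disc_neg isOrderEmbedding_sqrtNegThree.disc_neg
  by_cases hass : Associated (sqrtNegThree p) (sqrtNegThree q)
  · obtain ⟨u, hu⟩ := hass
    -- The unit relating `p` and `q` cannot lie in the order, for then `p` and `q` would be
    -- associates there.
    have hne : ∀ e, sqrtNegThree e ≠ u := by
      intro e he
      have heu : IsUnit e := isUnit_of_isUnit_map (he ▸ u.isUnit)
      refine hpq ⟨heu.unit, isOrderEmbedding_sqrtNegThree.injective ?_⟩
      rw [map_mul, heu.unit_spec, he, hu]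
    obtain ⟨y, hy⟩ := hpz
    obtain ⟨x, rfl⟩ := hqz
    have hp0 : sqrtNegThree p ≠ 0 := (irreducible_map hp).ne_zero
    have hxy : sqrtNegThree x * u = sqrtNegThree y := by
      apply mul_left_cancel₀ hp0
      rw [← map_mul sqrtNegThree p y, ← hy, map_mul, ← hu]
      ring
    -- Since `xu = y` with `u` outside the order, `2 ∣ x`. Writing `x = 2vw` with `w` in the order,
    -- `q' = 2v` and `p' = 2vu` give `pp' = qq'` because `q = pu`.
    obtain ⟨γ, hγ⟩ : 2 ∣ sqrtNegThree x := by
      by_contra h2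
      obtain ⟨e, he⟩ := exists_eq_of_mul_eq h2 hxy
      exact hne e he
    obtain ⟨v, w, hv, rfl⟩ := exists_eq_isUnit_mul γ
    obtain ⟨q', hq'⟩ := exists_eq_of_two_dvd (dvd_mul_right 2 v)
    obtain ⟨p', hp'⟩ := exists_eq_of_two_dvd (dvd_mul_right 2 (v * u))
    have h2 := prime_two_eisenstein.irreducible
    refine ⟨p', q', isOrderEmbedding_sqrtNegThree.irreducible_of_map ?_,
      isOrderEmbedding_sqrtNegThree.irreducible_of_map ?_, ?_, mul_dvd_mul_left q ⟨w, ?_⟩⟩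
    · rw [hp']; exact (irreducible_mul_isUnit (hv.mul u.isUnit)).2 h2
    · rw [hq']; exact (irreducible_mul_isUnit hv).2 h2
    · refine Associated.of_eq (isOrderEmbedding_sqrtNegThree.injective ?_)
      rw [map_mul, map_mul, hp', hq', ← hu]
      ring
    · apply isOrderEmbedding_sqrtNegThree.injective
      rw [hγ, map_mul, hq', mul_assoc]
  · have hdvd : p * q ∣ z := by
      -- Both `p` and `q` divisible by `2` would make them associated to `2` in `ℤ[ω]`, hence to
      -- each other; so one of them can be cancelled.
      by_cases hq2 : 2 ∣ sqrtNegThree q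
      · have hp2 : ¬ 2 ∣ sqrtNegThree p := fun hp2 => hass <|
          (prime_two_eisenstein.irreducible.associated_of_dvd (irreducible_map hp) hp2).symm.trans
            (prime_two_eisenstein.irreducible.associated_of_dvd (irreducible_map hq) hq2)
        rw [mul_comm]
        exact mul_dvd_of_not_associated hq hp hqz hpz (fun h => hass h.symm) hp2
      · exact mul_dvd_of_not_associated hp hq hpz hqz hass hq2
    exact ⟨q, p, hq, hp, Associated.of_eq (mul_comm p q), by rwa [mul_comm]⟩

theorem isIDPD : IsIDPD (ℤ√(-3)) where
  isDomain := isOrderEmbedding_sqrtNegThree.isDomain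
  atomic := isOrderEmbedding_sqrtNegThree.exists_multiset
  exists_pair _ hz _ _ _ hp hq hpz hqz hpq := exists_pair hz hp hq hpz hqz hpq

/-! ### `ℤ[√-3]` as a non-integrally closed order of `ℚ(√-3)`. -/

theorem not_isIntegrallyClosed : ¬ IsIntegrallyClosed (ℤ√(-3)) := by
  intro h
  have := isOrderEmbedding_sqrtNegThree.isDomain
  let s : ℤ√(-3) := ⟨1, 1⟩
  have h2 : (2 : FractionRing (ℤ√(-3))) ≠ 0 := by
    rw [← map_ofNat (algebraMap (ℤ√(-3)) (FractionRing (ℤ√(-3)))), Ne,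
      map_eq_zero_iff _ (IsFractionRing.injective (ℤ√(-3)) _)]
    decide
  let x : FractionRing (ℤ√(-3)) := algebraMap (ℤ√(-3)) _ s / 2
  -- Divided by `4`, this is `x² - x + 1 = 0` for `x = (1 + √-3)/2`.
  have hs : s ^ 2 = 2 * s - 4 := by decide
  have hx : IsIntegral (ℤ√(-3)) x := by
    refine ⟨Polynomial.X ^ 2 - Polynomial.X + 1, by monicity!, ?_⟩
    have := congrArg (algebraMap (ℤ√(-3)) (FractionRing (ℤ√(-3)))) hs
    simp only [map_pow, map_sub, map_mul, map_ofNat] at this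
    simp only [Polynomial.eval₂_add, Polynomial.eval₂_sub, Polynomial.eval₂_pow,
      Polynomial.eval₂_X, Polynomial.eval₂_one, x]
    field_simp
    linear_combination this
  obtain ⟨y, hy⟩ := IsIntegrallyClosed.isIntegral_iff.1 hx
  have hys : y * 2 = s := by
    apply IsFractionRing.injective (ℤ√(-3)) (FractionRing (ℤ√(-3)))
    rw [map_mul, hy, map_ofNat, div_mul_cancel₀ _ h2]
  have := congrArg Zsqrtd.re hys
  simp [s] at this
  omega

instance : Fact (∀ r : ℚ, r ^ 2 ≠ -3 + 0 * r) :=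
  ⟨fun r h => by nlinarith [sq_nonneg r]⟩

instance : NumberField (QuadraticAlgebra ℚ (-3) 0) where
  to_charZero := inferInstance
  to_finiteDimensional := by
    convert (inferInstance : Module.Finite ℚ (QuadraticAlgebra ℚ (-3) 0))

theorem isImaginaryQuadraticField : IsImaginaryQuadraticField (QuadraticAlgebra ℚ (-3) 0) where
  finrank_eq_two := by
    convert QuadraticAlgebra.finrank_eq_two (R := ℚ) (-3) 0
  isTotallyComplex := by
    refine ⟨fun v => ?_⟩
    rw [← NumberField.InfinitePlace.not_isReal_iff_isComplex]
    rintro ⟨φ, hφ, -⟩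
    have h1 := congrArg φ (show (⟨0, 1⟩ : QuadraticAlgebra ℚ (-3) 0) ^ 2 = -3 by
      rw [sq]; ext <;> simp)
    have h2 := congrArg (fun f => f ⟨0, 1⟩) hφ
    have him := Complex.conj_eq_iff_im.1 h2
    rw [map_pow, map_neg, map_ofNat] at h1
    have hre := congrArg Complex.re h1
    simp [sq, him] at hre
    nlinarith

/-- The embedding of `ℤ[√-3]` into the field `ℚ(√-3)`. -/
def toField : ℤ√(-3) →+* QuadraticAlgebra ℚ (-3) 0 :=
  Zsqrtd.lift ⟨⟨0, 1⟩, by ext <;> simp⟩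

theorem toField_apply (z : ℤ√(-3)) : toField z = ⟨z.re, z.im⟩ := by
  ext <;> simp [toField]

theorem isImaginaryQuadraticOrder : IsImaginaryQuadraticOrder (ℤ√(-3)) := by
  refine ⟨QuadraticAlgebra ℚ (-3) 0, inferInstance, inferInstance, isImaginaryQuadraticField,
    toField.range, ⟨?_, ?_⟩, ⟨RingEquiv.ofBijective toField.rangeRestrict
      ⟨fun x y h => ?_, toField.rangeRestrict_surjective⟩⟩⟩
  · have hfin : Module.Finite ℤ (ℤ√(-3)) := by
      refine ⟨⟨{1, Zsqrtd.sqrtd}, ?_⟩⟩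
      rw [eq_top_iff]
      intro z _
      rw [Finset.coe_pair, Submodule.mem_span_pair]
      exact ⟨z.re, z.im, by ext <;> simp⟩
    exact Module.Finite.of_surjective toField.rangeRestrict.toIntAlgHom.toLinearMap
      toField.rangeRestrict_surjective
  · rw [eq_top_iff]
    intro z _
    have hz : z = (z.re : QuadraticAlgebra ℚ (-3) 0) * 1 +
        (z.im : QuadraticAlgebra ℚ (-3) 0) * ⟨0, 1⟩ := by
      ext <;> simp
    rw [hz, ← Rat.smul_def, ← Rat.smul_def]
    exact Submodule.add_mem _
      (Submodule.smul_mem _ _ (Submodule.subset_span ⟨1, map_one _⟩))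
      (Submodule.smul_mem _ _ (Submodule.subset_span ⟨⟨0, 1⟩, by simp [toField_apply]⟩))
  · have h' := congrArg Subtype.val h
    simp only [RingHom.coe_rangeRestrict, toField_apply, QuadraticAlgebra.mk.injEq,
      Int.cast_inj] at h'
    ext
    exacts [h'.1, h'.2]

end SqrtNegThree

theorem theorem2p10 :
    IsIDPD (ℤ√(-3)) ∧
    IsImaginaryQuadraticOrder (ℤ√(-3)) ∧
    ¬ IsIntegrallyClosed (ℤ√(-3)) ∧
    ∀ (D : Type u) [CommRing D], IsImaginaryQuadraticOrder D → ¬ IsIntegrallyClosed D →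
      IsIDPD D → Nonempty (D ≃+* ℤ√(-3)) :=
  ⟨SqrtNegThree.isIDPD, SqrtNegThree.isImaginaryQuadraticOrder,
    SqrtNegThree.not_isIntegrallyClosed, fun _ _ hq hic hD => hD.nonempty_ringEquiv hq hic⟩
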